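/- All digraphs are finite, without loops and without parallel arcs; digons (pairs of opposite arcs) are allowed. A digraph $D$ is \emph{semi-complete} if for all distinct vertices $u,v$ at least one of the arcs $uv$, $vu$ exists. A \emph{$k$-dicolouring} of $D$ is a map $\phi:V(D)\to\{1,\dots,k\}$ such that each $\phi^{-1}(i)$ induces an acyclic digraph, i.e. one containing no directed cycle (a digon counts as a directed cycle of length $2$). $D$ is \emph{$3$-dicritical} if $D$ admits no $2$-dicolouring but every proper subdigraph of $D$ (obtained by deleting vertices and/or arcs) does. Let $\overleftrightarrow{K_n}$ be the bidirected complete graph on $n$ vertices (all arcs $uv$ with $u\ne v$) and $\vec{C_3}$ the directed triangle. Let $\vec{W_3}$ be obtained from $\vec{C_3}$ by adding one vertex linked by a digon to each vertex of the triangle. Let $\mathcal H_5$ be the digraph on $\{u_0,\dots,u_4\}$ with arcs $u_0u_1,u_1u_0,u_0u_4,u_4u_0,u_4u_1,u_1u_3,u_1u_2,u_3u_4,u_2u_4,u_3u_0,u_0u_2,u_2u_3$. For digraphs $H_1,H_2$ let $\mathcal R(H_1,H_2)$ be obtained from disjoint copies of $H_1$ and $H_2$ and one new vertex $r$ by adding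 all arcs from $H_1$ to $H_2$, all arcs from $H_2$ to $r$ and all arcs from $r$ to $H_1$. Let $\mathcal P_7$ be the Paley tournament on $\mathbb Z/7$, with arcs $i\to i+1$, $i\to i+2$, $i\to i+4$ for every $i\in\mathbb Z/7$. \textbf{Theorem.} Up to isomorphism there are exactly eight $3$-dicritical semi-complete digraphs, namely $\overleftrightarrow{K_3}$, $\vec{W_3}$, $\mathcal H_5$, $\mathcal R(\overleftrightarrow{K_2},\overleftrightarrow{K_2})$, $\mathcal R(\overleftrightarrow{K_2},\vec{C_3})$, $\mathcal R(\vec{C_3},\overleftrightarrow{K_2})$, $\mathcal R(\vec{C_3},\vec{C_3})$ and $\mathcal P_7$. That is, these eight digraphs are pairwise non-isomorphic, and a digraph is both semi-complete and $3$-dicritical if and only if it is isomorphic to one of them. -/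

import Mathlib

/-!  Finite digraphs are Mathlib's `Digraph V` with `V` finite; being loopless is a separate
predicate.  Parallel arcs are impossible by construction, digons are allowed. -/

namespace Digraph

universe u v

variable {V : Type u} {W : Type v}

/-- No arc from a vertex to itself. -/
def IsLoopless (D : Digraph V) : Prop := ∀ v, ¬ D.Adj v v

/-- Between any two distinct vertices there is an arc in at least one direction. -/
def IsSemicomplete (D : Digraph V) : Prop := ∀ u v, u ≠ v → D.Adj u v ∨ D.Adj v u

/-- A subdigraph of `D`: a set of vertices of `D`, together with a set of arcs of `D` all of
whose endpoints lie in that set. -/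
structure Subdigraph (D : Digraph V) where
  verts : Set V
  Adj : V → V → Prop
  adj_sub : ∀ u v, Adj u v → D.Adj u v
  left_mem : ∀ u v, Adj u v → u ∈ verts
  right_mem : ∀ u v, Adj u v → v ∈ verts

/-- A subdigraph as a digraph on its own vertex set. -/
def Subdigraph.toDigraph {D : Digraph V} (S : D.Subdigraph) : Digraph S.verts where
  Adj a b := S.Adj a b

/-- A subdigraph is proper if it misses at least one vertex or at least one arc. -/
def Subdigraph.IsProper {D : Digraph V} (S : D.Subdigraph) : Prop :=
  S.verts ≠ Set.univ ∨ S.Adj ≠ D.Adj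

/-- The subdigraph induced by a set of vertices. -/
def induce (D : Digraph V) (s : Set V) : Digraph s where
  Adj a b := D.Adj a b

/-- The directed cycle on `n` vertices (meant for `n ≥ 2`; for `n = 2` it is a digon). -/
def directedCycle (n : ℕ) : Digraph (Fin n) where
  Adj i j := (j : ℕ) = ((i : ℕ) + 1) % n

/-- `D` has a (not necessarily induced) subdigraph isomorphic to `H`. -/
def Contains (D : Digraph V) (H : Digraph W) : Prop :=
  ∃ f : W → V, Function.Injective f ∧ ∀ a b, H.Adj a b → D.Adj (f a) (f b)

/-- A digraph is acyclic if it contains no directed cycle. -/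
def IsAcyclic (D : Digraph V) : Prop := ∀ n : ℕ, 2 ≤ n → ¬ D.Contains (directedCycle n)

/-- `k`-dicolourability: the vertices can be coloured with `k` colours in such a way that every
colour class induces an acyclic digraph. -/
def IsDicolourable (D : Digraph V) (k : ℕ) : Prop :=
  ∃ φ : V → Fin k, ∀ i : Fin k, (D.induce {v | φ v = i}).IsAcyclic

/-- `k`-dicritical digraphs, for `k ≥ 1`: not `(k - 1)`-dicolourable, but every proper subdigraph
is. -/
def IsDicritical (D : Digraph V) (k : ℕ) : Prop :=
  ¬ D.IsDicolourable (k - 1) ∧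
    ∀ S : D.Subdigraph, S.IsProper → S.toDigraph.IsDicolourable (k - 1)

/-- Isomorphism of digraphs. -/
def IsIsomorphic (D : Digraph V) (H : Digraph W) : Prop := Nonempty (D.Adj ≃r H.Adj)

/-- The bidirected complete graph on `n` vertices. -/
def bidirectedComplete (n : ℕ) : Digraph (Fin n) where
  Adj i j := i ≠ j

/-- The directed wheel `W₃`: a directed triangle and a centre `none` that is linked by a digon to
each vertex of the triangle. -/
def directedWheel3 : Digraph (Option (Fin 3)) where
  Adj
    | none, none => False
    | none, some _ => True
    | some _, none => True
    | some i, some j => (directedCycle 3).Adj i j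

/-- The digraph `H₅`: two digons `{0, 1}`, `{0, 4}` and eight simple arcs. -/
def H5 : Digraph (Fin 5) where
  Adj i j := (i, j) ∈ ([(0, 1), (1, 0), (0, 4), (4, 0), (4, 1), (1, 3), (1, 2), (3, 4), (2, 4),
    (3, 0), (0, 2), (2, 3)] : List (Fin 5 × Fin 5))

/-- The rotative digraph `R(H₁, H₂)`: disjoint copies of `H₁` and `H₂` and one further vertex
`none`, with all arcs from `H₁` to `H₂`, from `H₂` to `none`, and from `none` to `H₁`. -/
def rotative (H₁ : Digraph V) (H₂ : Digraph W) : Digraph (Option (V ⊕ W)) where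
  Adj
    | some (.inl a), some (.inl b) => H₁.Adj a b
    | some (.inr a), some (.inr b) => H₂.Adj a b
    | some (.inl _), some (.inr _) => True
    | some (.inr _), none => True
    | none, some (.inl _) => True
    | _, _ => False

/-- The Paley tournament on seven vertices; `1, 2, 4` are the non-zero squares modulo `7`. -/
def paley7 : Digraph (ZMod 7) where
  Adj i j := j = i + 1 ∨ j = i + 2 ∨ j = i + 4

/-- The eight digraphs of the classification. -/
def eightDigraphs : Fin 8 → (X : Type) × Digraph X :=
  ![⟨_, bidirectedComplete 3⟩,
    ⟨_, directedWheel3⟩,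
    ⟨_, H5⟩,
    ⟨_, rotative (bidirectedComplete 2) (bidirectedComplete 2)⟩,
    ⟨_, rotative (bidirectedComplete 2) (directedCycle 3)⟩,
    ⟨_, rotative (directedCycle 3) (bidirectedComplete 2)⟩,
    ⟨_, rotative (directedCycle 3) (directedCycle 3)⟩,
    ⟨_, paley7⟩]

end Digraph

/-!
A semicomplete digraph without digons and directed triangles is a strict order, so a `2`-dicolouring
of a semicomplete digraph is a `2`-colouring without monochromatic digons and triangles
(`IsGood`). Deleting an arc `uv` can be replaced by reversing it, which keeps the digraph
semicomplete. Thus a semicomplete digraph `D` is `3`-dicritical if and only if it has no good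
colouring, but for each arc `uv` the digraph with `uv` reversed has a good colouring in which `u`
and `v` have the same colour (`IsCritical`, `isDicritical_three_iff`).

Both halves of this are used locally. The restriction of the colouring for `uv` to any set of
vertices containing `u` and `v` is still good, so a small configuration in which some arc has no
such colouring does not occur in `D`. Moreover, if `uv` is not in a digon, then its class contains
a vertex `w` with `v → w → u` (`IsCritical.exists_witness`). If no vertex of the configuration
can play the role of `w`, then it has to be enlarged by a new vertex, and all ways to join this
vertex to the old ones are examined. Likewise, a configuration with a good colouring does not
exhaust `D`. Starting from a digon or an induced directed triangle, one of which is contained in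
`D`, this search never exceeds eight vertices, and every branch that is not contradictory runs into
one of the eight digraphs. The search is recorded in the proof trees `refutations`, whose checker is
proved sound in `Refutation.excluded_of_check` and is evaluated in the kernel.

Finally, a critical digraph that contains one of the eight is equal to it
(`IsCritical.hasCode`), the eight digraphs are critical by direct computation, and their degrees
distinguish them.
-/

namespace Digraph

universe u v

variable {V : Type u} {W : Type v}

/-! ### Good colourings and critical semicomplete digraphs -/

/-- A `2`-colouring without monochromatic digons and monochromatic directed triangles. For a
loopless semicomplete digraph this is the same as a `2`-dicolouring, see
`IsGood.isDicolourable` and `isGood_of_isAcyclic`. -/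
def IsGood (D : Digraph V) (φ : V → Bool) : Prop :=
  ∀ x y, D.Adj x y → φ x = φ y →
    ¬ D.Adj y x ∧ ∀ z, φ z = φ x → D.Adj y z → ¬ D.Adj z x

/-- The digraph obtained by replacing the arc `uv` by the arc `vu`. In contrast to the deletion of
`uv`, this keeps the digraph semicomplete. -/
def reverseArc (D : Digraph V) (u v : V) : Digraph V where
  Adj x y := (D.Adj x y ∧ ¬ (x = u ∧ y = v)) ∨ (x = v ∧ y = u)

/-- A digraph whose arcs respect a strict order is acyclic. -/
theorem isAcyclic_of_strictOrder {D : Digraph V} (r : V → V → Prop) (hirr : ∀ x, ¬ r x x)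
    (htr : ∀ x y z, r x y → r y z → r x z) (h : ∀ x y, D.Adj x y → r x y) : D.IsAcyclic := by
  rintro n hn ⟨f, -, hf⟩
  obtain ⟨m, rfl⟩ : ∃ m, n = m + 2 := ⟨n - 2, by omega⟩
  have key : ∀ k : ℕ, (hk : k + 1 < m + 2) → r (f ⟨0, by omega⟩) (f ⟨k + 1, hk⟩) := by
    intro k
    induction k with
    | zero =>
      intro hk
      exact h _ _ (hf _ _ (by simp [directedCycle]))
    | succ k ih =>
      intro hk
      refine htr _ _ _ (ih (by omega)) (h _ _ (hf _ _ ?_))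
      simp only [directedCycle]
      rw [Nat.mod_eq_of_lt (by omega)]
  refine hirr _ (htr _ _ _ (key m (by omega)) (h _ _ (hf _ _ ?_)))
  simp [directedCycle]

theorem IsAcyclic.not_digon {D : Digraph V} (h : D.IsAcyclic) {x y : V} (hne : x ≠ y)
    (hxy : D.Adj x y) (hyx : D.Adj y x) : False := by
  refine h 2 le_rfl ⟨![x, y], ?_, ?_⟩
  · intro a b hab
    fin_cases a <;> fin_cases b <;> simp_all
  · intro a b hab
    fin_cases a <;> fin_cases b <;> simp_all [directedCycle]

theorem IsAcyclic.not_triangle {D : Digraph V} (h : D.IsAcyclic) {x y z : V} (hne : x ≠ y)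
    (hne' : y ≠ z) (hne'' : z ≠ x) (hxy : D.Adj x y) (hyz : D.Adj y z) (hzx : D.Adj z x) :
    False := by
  refine h 3 (by norm_num) ⟨![x, y, z], ?_, ?_⟩
  · intro a b hab
    fin_cases a <;> fin_cases b <;> simp_all
  · intro a b hab
    fin_cases a <;> fin_cases b <;> simp_all [directedCycle]

/-- In a semicomplete digraph the arcs inside a class of a good colouring form a strict order, so
a good colouring pulls back to a dicolouring of every digraph that maps to it. -/
theorem IsGood.isDicolourable {D : Digraph V} (hl : D.IsLoopless) (hs : D.IsSemicomplete)
    {φ : V → Bool} (hφ : D.IsGood φ) {H : Digraph W} (f : W → V)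
    (hf : ∀ x y, H.Adj x y → D.Adj (f x) (f y)) : H.IsDicolourable 2 := by
  refine ⟨fun w => if φ (f w) then 1 else 0, fun i => ?_⟩
  refine isAcyclic_of_strictOrder
    (fun x y => D.Adj (f x) (f y)) (fun x => hl _) ?_ (fun x y h => hf _ _ h)
  rintro ⟨x, hx⟩ ⟨y, hy⟩ ⟨z, hz⟩ hxy hyz
  simp only [Set.mem_ofPred_eq] at hx hy hz hxy hyz ⊢
  have h1 : φ (f x) = φ (f y) := by
    cases h : φ (f x) <;> cases h' : φ (f y) <;> simp_all <;> omega
  have h2 : φ (f z) = φ (f x) := by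
    cases h : φ (f x) <;> cases h' : φ (f z) <;> simp_all <;> omega
  obtain ⟨hd, ht⟩ := hφ _ _ hxy h1
  rcases hs (f x) (f z) (by rintro he; exact hd (he ▸ hyz)) with h | h
  · exact h
  · exact absurd h (ht _ h2 hyz)

theorem isSemicomplete_reverseArc {D : Digraph V} (hs : D.IsSemicomplete) (u v : V) :
    (D.reverseArc u v).IsSemicomplete := by
  intro x y hxy
  have := hs x y hxy
  simp only [reverseArc]
  by_cases h1 : x = u ∧ y = v
  · exact Or.inr (Or.inr ⟨h1.2, h1.1⟩)
  · by_cases h2 : y = u ∧ x = v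
    · exact Or.inl (Or.inr ⟨h2.2, h2.1⟩)
    · rcases this with h | h
      · exact Or.inl (Or.inl ⟨h, h1⟩)
      · exact Or.inr (Or.inl ⟨h, h2⟩)

theorem isLoopless_reverseArc {D : Digraph V} (hl : D.IsLoopless) {u v : V} (h : u ≠ v) :
    (D.reverseArc u v).IsLoopless := by
  rintro x (hx | hx)
  · exact hl _ hx.1
  · exact h (hx.2.symm.trans hx.1)

theorem isGood_of_isAcyclic {D : Digraph V} (hl : D.IsLoopless) {φ : V → Fin 2}
    (hφ : ∀ i, (D.induce {v | φ v = i}).IsAcyclic) : D.IsGood (fun x => decide (φ x = 1)) := by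
  have key : ∀ x y, decide (φ x = 1) = decide (φ y = 1) → φ x = φ y := by
    intro x y h
    have h' := decide_eq_decide.1 h
    omega
  have hne : ∀ x y, D.Adj x y → x ≠ y := by
    rintro x y h rfl
    exact hl _ h
  intro x y hxy h
  have h := key _ _ h
  refine ⟨fun hyx => ?_, fun z hz hyz hzx => ?_⟩
  · exact (hφ (φ x)).not_digon (x := ⟨x, rfl⟩) (y := ⟨y, h.symm⟩)
      (fun he => hne _ _ hxy (congrArg Subtype.val he)) hxy hyx
  · exact (hφ (φ x)).not_triangle (x := ⟨x, rfl⟩) (y := ⟨y, h.symm⟩) (z := ⟨z, key _ _ hz⟩)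
      (fun he => hne _ _ hxy (congrArg Subtype.val he))
      (fun he => hne _ _ hyz (congrArg Subtype.val he))
      (fun he => hne _ _ hzx (congrArg Subtype.val he)) hxy hyz hzx

/-- The form of `3`-dicriticality that the classification works with: there is no good colouring,
but after the reversal of any arc `uv` there is one that gives `u` and `v` the same colour. For
semicomplete digraphs it is equivalent to `IsDicritical 3`, see `isDicritical_three_iff`. -/
structure IsCritical (D : Digraph V) : Prop where
  not_good : ∀ φ, ¬ D.IsGood φ
  good : ∀ u v, D.Adj u v → ∃ φ : V → Bool, φ u = φ v ∧ (D.reverseArc u v).IsGood φ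

/-- The digraph without the arc `uv`. -/
def deleteArc (D : Digraph V) (u v : V) : Digraph V where
  Adj x y := D.Adj x y ∧ ¬ (x = u ∧ y = v)

/-- A colouring that is good for `D` without `uv`, but not for `D`, puts a path of length one or two
from `v` to `u` into the class of `u` and `v`. A monochromatic triangle `v → u → z → v` after the
reversal would close with this path to a cycle that avoids `uv`, and a chord of that cycle makes
it a digon or a triangle. -/
theorem IsGood.reverseArc_of_deleteArc {D : Digraph V} (hl : D.IsLoopless) (hs : D.IsSemicomplete)
    {u v : V} {φ : V → Bool} (hφ : (D.deleteArc u v).IsGood φ) (hD : ¬ D.IsGood φ) :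
    φ u = φ v ∧ (D.reverseArc u v).IsGood φ := by
  -- the unfolded form of `hl` is what `grind` needs below
  have hloop : ∀ x, ¬ D.Adj x x := hl
  -- a monochromatic digon or triangle of `D`
  have hviol : ∃ x y, D.Adj x y ∧ φ x = φ y ∧
      (D.Adj y x ∨ ∃ z, φ z = φ x ∧ D.Adj y z ∧ D.Adj z x) := by
    by_contra hcon
    push Not at hcon
    exact hD fun x y hxy h => ⟨(hcon x y hxy h).1, (hcon x y hxy h).2⟩
  set H := D.deleteArc u v with hH
  have hHD : ∀ x y, H.Adj x y ↔ D.Adj x y ∧ ¬ (x = u ∧ y = v) := fun x y => Iff.rfl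
  have hRD : ∀ x y, (D.reverseArc u v).Adj x y ↔ H.Adj x y ∨ (x = v ∧ y = u) := fun x y => Iff.rfl
  have hdig : ∀ x y, φ x = φ y → H.Adj x y → ¬ H.Adj y x := fun x y h hxy => (hφ x y hxy h).1
  have htri : ∀ x y z, φ x = φ y → φ z = φ x → H.Adj x y → H.Adj y z → ¬ H.Adj z x :=
    fun x y z h h' hxy => (hφ x y hxy h).2 z h'
  have hpath : φ u = φ v ∧ D.Adj u v ∧
      (H.Adj v u ∨ ∃ w, φ w = φ u ∧ H.Adj v w ∧ H.Adj w u) := by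
    obtain ⟨x, y, hxy, h, hyx | ⟨z, hz, hyz, hzx⟩⟩ := hviol
    · by_cases h1 : x = u ∧ y = v
      · obtain ⟨rfl, rfl⟩ := h1
        exact ⟨h, hxy, Or.inl ⟨hyx, by grind⟩⟩
      · by_cases h2 : y = u ∧ x = v
        · obtain ⟨rfl, rfl⟩ := h2
          exact ⟨h.symm, hyx, Or.inl ⟨hxy, by grind⟩⟩
        · exact absurd ⟨hyx, h2⟩ (hdig x y h ⟨hxy, h1⟩)
    · by_cases h1 : x = u ∧ y = v
      · obtain ⟨rfl, rfl⟩ := h1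
        exact ⟨h, hxy, Or.inr ⟨z, hz, ⟨hyz, by grind⟩, ⟨hzx, by grind⟩⟩⟩
      · by_cases h2 : y = u ∧ z = v
        · obtain ⟨rfl, rfl⟩ := h2
          exact ⟨by grind, hyz, Or.inr ⟨x, h, ⟨hzx, by grind⟩, ⟨hxy, by grind⟩⟩⟩
        · by_cases h3 : z = u ∧ x = v
          · obtain ⟨rfl, rfl⟩ := h3
            exact ⟨hz, hzx, Or.inr ⟨y, by grind, ⟨hxy, by grind⟩, ⟨hyz, by grind⟩⟩⟩
          · exact absurd ⟨hzx, h3⟩ (htri x y z h hz ⟨hxy, h1⟩ ⟨hyz, h2⟩)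
  obtain ⟨huv, hadj, hpath⟩ := hpath
  have hne : u ≠ v := by rintro rfl; exact hl _ hadj
  have hA : ∀ z, φ z = φ u → H.Adj u z → ¬ H.Adj z v := by
    intro z hz huz hzv
    rcases hpath with hvu | ⟨w, hw, hvw, hwu⟩
    · exact htri v u z huv.symm (hz.trans huv) hvu huz hzv
    · have hzw : z ≠ w := by
        rintro rfl
        exact hdig u z hz.symm huz hwu
      rcases hs z w hzw with h | h
      · have h' : H.Adj z w := ⟨h, by rintro ⟨rfl, -⟩; exact hl _ huz.1⟩
        exact htri u z w hz.symm hw huz h' hwu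
      · have h' : H.Adj w z := ⟨h, by rintro ⟨rfl, -⟩; exact hl _ hwu.1⟩
        exact htri z v w (hz.trans huv) (hw.trans hz.symm) hzv hvw h'
  have huv' : ¬ H.Adj u v := fun h => h.2 ⟨rfl, rfl⟩
  refine ⟨huv, fun x y hxy h => ⟨fun hyx => ?_, fun z hz hyz hzx => ?_⟩⟩
  · rw [hRD] at hxy hyx
    grind
  · rw [hRD] at hxy hyz hzx
    grind

/-- Reversing an arc `uv` of a semicomplete digraph yields a semicomplete digraph that still
contains every subdigraph without `uv`; conversely a dicolouring after the deletion of `uv` survives the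
reversal by `IsGood.reverseArc_of_deleteArc`. -/
theorem isDicritical_three_iff {D : Digraph V} (hl : D.IsLoopless) (hs : D.IsSemicomplete) :
    D.IsDicritical 3 ↔ D.IsCritical := by
  constructor
  · rintro ⟨hD, hS⟩
    have hgood : ∀ φ, ¬ D.IsGood φ := fun φ hφ =>
      hD (hφ.isDicolourable hl hs id fun _ _ h => h)
    refine ⟨hgood, fun u v huv => ?_⟩
    set S : D.Subdigraph := ⟨Set.univ, (D.deleteArc u v).Adj, fun _ _ h => h.1,
      fun _ _ _ => trivial, fun _ _ _ => trivial⟩ with hSdef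
    obtain ⟨φ, hφ⟩ := hS S (Or.inr fun h => by
      have : (D.deleteArc u v).Adj u v := by
        rw [show (D.deleteArc u v).Adj = D.Adj from h]; exact huv
      exact this.2 ⟨rfl, rfl⟩)
    have hg := isGood_of_isAcyclic
      (fun x (hx : S.toDigraph.Adj x x) => hl _ (S.adj_sub _ _ hx)) hφ
    have hg' : (D.deleteArc u v).IsGood fun x => decide (φ ⟨x, trivial⟩ = 1) := by
      intro x y hxy h
      obtain ⟨h1, h2⟩ := hg ⟨x, trivial⟩ ⟨y, trivial⟩ hxy h
      exact ⟨h1, fun z => h2 ⟨z, trivial⟩⟩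
    exact ⟨fun x => decide (φ ⟨x, trivial⟩ = 1),
      hg'.reverseArc_of_deleteArc hl hs (hgood _)⟩
  · rintro ⟨hgood, hrev⟩
    constructor
    · rintro ⟨φ, hφ⟩
      exact hgood _ (isGood_of_isAcyclic hl hφ)
    · intro S hS
      -- an arc of `D` that `S` lacks
      obtain ⟨u, v, huv, hnot⟩ : ∃ u v, D.Adj u v ∧ ¬ S.Adj u v := by
        rcases hS with hS | hS
        · obtain ⟨x, hx⟩ := (Set.ne_univ_iff_exists_notMem _).1 hS
          obtain ⟨y, hy⟩ : ∃ y, x ≠ y := by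
            by_contra hcon
            push Not at hcon
            refine hgood (fun _ => true) fun a b hab => ?_
            rw [← hcon a, ← hcon b] at hab
            exact absurd hab (hl x)
          rcases hs x y hy with h | h
          · exact ⟨x, y, h, fun h' => hx (S.left_mem _ _ h')⟩
          · exact ⟨y, x, h, fun h' => hx (S.right_mem _ _ h')⟩
        · by_contra hcon
          push Not at hcon
          exact hS (funext₂ fun a b => propext ⟨S.adj_sub a b, hcon a b⟩)
      obtain ⟨φ, -, hφ⟩ := hrev u v huv
      have hne : u ≠ v := by rintro rfl; exact hl _ huv
      refine hφ.isDicolourable (isLoopless_reverseArc hl hne) (isSemicomplete_reverseArc hs u v)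
        Subtype.val fun a b hab => Or.inl ⟨S.adj_sub _ _ hab, ?_⟩
      rintro ⟨ha, hb⟩
      have hab : S.Adj a b := hab
      rw [ha, hb] at hab
      exact hnot hab

/-- The colour class of a simple arc `uv` contains a directed triangle through `uv`, as the
colouring is good after the reversal of `uv` only. -/
theorem IsCritical.exists_witness {D : Digraph V} (hD : D.IsCritical) {u v : V} (huv : D.Adj u v)
    (hvu : ¬ D.Adj v u) : ∃ φ : V → Bool, φ u = φ v ∧ (D.reverseArc u v).IsGood φ ∧
      ∃ w, φ w = φ u ∧ D.Adj v w ∧ D.Adj w u := by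
  obtain ⟨φ, h, hφ⟩ := hD.good u v huv
  refine ⟨φ, h, hφ, ?_⟩
  by_contra hcon
  push Not at hcon
  have hR : ∀ x y, D.Adj x y → ¬ (x = u ∧ y = v) → (D.reverseArc u v).Adj x y :=
    fun x y hxy hne => Or.inl ⟨hxy, hne⟩
  refine hD.not_good φ fun x y hxy hc => ⟨fun hyx => ?_, fun z hz hyz hzx => ?_⟩
  · have h1 : ¬ (x = u ∧ y = v) := by rintro ⟨rfl, rfl⟩; exact hvu hyx
    have h2 : ¬ (y = u ∧ x = v) := by rintro ⟨rfl, rfl⟩; exact hvu hxy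
    exact (hφ x y (hR _ _ hxy h1) hc).1 (hR _ _ hyx h2)
  · have h1 : ¬ (x = u ∧ y = v) := by rintro ⟨rfl, rfl⟩; exact hcon z hz hyz hzx
    have h2 : ¬ (y = u ∧ z = v) := by rintro ⟨rfl, rfl⟩; exact hcon x hc hzx hxy
    have h3 : ¬ (z = u ∧ x = v) := by
      rintro ⟨rfl, rfl⟩; exact hcon y (hc.symm.trans hz.symm) hxy hyz
    exact (hφ x y (hR _ _ hxy h1) hc).2 z hz (hR _ _ hyz h2) (hR _ _ hzx h3)

/-! ### Colourings of encoded digraphs -/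

/-- Sets of arcs on at most eight vertices are encoded as natural numbers: the arc from `i` to `j`
is present if and only if bit `8 * i + j` is set. -/
def hasBit (c i j : ℕ) : Bool := c.testBit (8 * i + j)

/-- The code of the single arc from `i` to `j`. -/
def arcBit (i j : ℕ) : ℕ := 2 ^ (8 * i + j)

theorem hasBit_lor_arcBit {c x y i j : ℕ} (hy : y < 8) (hj : j < 8) :
    hasBit (c ||| arcBit x y) i j = (hasBit c i j || (decide (i = x) && decide (j = y))) := by
  simp only [hasBit, arcBit, Nat.testBit_or, Nat.testBit_two_pow]
  congr 1
  rw [← Bool.decide_and, decide_eq_decide]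
  omega

/-- Adding the vertex `x` to the set `S` creates no digon and no triangle through `x`. -/
def fits (c x : ℕ) (S : List ℕ) : Bool :=
  S.all fun y => !hasBit c x y ||
    (!hasBit c y x && S.all fun z => !(hasBit c y z && hasBit c z x))

/-- The vertices of the first list can be distributed over the two colour classes `A` and `B`
without creating a monochromatic digon or triangle. -/
def canDistribute (c : ℕ) : List ℕ → List ℕ → List ℕ → Bool
  | [], _, _ => true
  | x :: xs, A, B =>
    (fits c x A && canDistribute c xs (x :: A) B) || (fits c x B && canDistribute c xs A (x :: B))

/-- The code after the reversal of the arc from `u` to `v`. -/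
def revCode (c u v : ℕ) : ℕ := (c ^^^ (c &&& arcBit u v)) ||| arcBit v u

theorem hasBit_revCode {c u v i j : ℕ} (hu : u < 8) (hv : v < 8) (hj : j < 8) :
    hasBit (revCode c u v) i j =
      ((hasBit c i j && !(decide (i = u) && decide (j = v))) ||
        (decide (i = v) && decide (j = u))) := by
  rw [revCode, hasBit_lor_arcBit hu hj]
  congr 1
  simp only [hasBit, arcBit, Nat.testBit_xor, Nat.testBit_and, Nat.testBit_two_pow]
  have : decide (8 * u + v = 8 * i + j) = (decide (i = u) && decide (j = v)) := by
    rw [← Bool.decide_and, decide_eq_decide]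
    omega
  rw [this]
  cases c.testBit (8 * i + j) <;> cases (decide (i = u) && decide (j = v)) <;> rfl

section

variable {D : Digraph V} {f : ℕ → V} {φ : V → Bool} {c : ℕ}

theorem fits_eq_true (hφ : D.IsGood φ) {x : ℕ} {S vs : List ℕ} (hx : x ∈ vs) (hS : ∀ y ∈ S, y ∈ vs)
    (hf : ∀ i ∈ vs, ∀ j ∈ vs, hasBit c i j → D.Adj (f i) (f j))
    (hc : ∀ y ∈ S, φ (f y) = φ (f x)) : fits c x S = true := by
  simp only [fits, List.all_eq_true, Bool.or_eq_true, Bool.and_eq_true, Bool.not_eq_true',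
    Bool.and_eq_false_iff]
  intro y hy
  rw [or_iff_not_imp_left, Bool.not_eq_false]
  intro hxy
  obtain ⟨h1, h2⟩ := hφ _ _ (hf _ hx _ (hS _ hy) hxy) (hc _ hy).symm
  refine ⟨Bool.eq_false_iff.2 fun h => h1 (hf _ (hS _ hy) _ hx h), fun z hz => ?_⟩
  rw [or_iff_not_imp_left, Bool.not_eq_false]
  intro hyz
  exact Bool.eq_false_iff.2 fun h =>
    h2 _ (hc _ hz) (hf _ (hS _ hy) _ (hS _ hz) hyz) (hf _ (hS _ hz) _ hx h)

theorem canDistribute_eq_true (hφ : D.IsGood φ) {vs : List ℕ}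
    (hf : ∀ i ∈ vs, ∀ j ∈ vs, hasBit c i j → D.Adj (f i) (f j)) (xs A B : List ℕ) (b : Bool)
    (hxs : ∀ x ∈ xs, x ∈ vs) (hA : ∀ x ∈ A, x ∈ vs) (hB : ∀ x ∈ B, x ∈ vs)
    (hA' : ∀ x ∈ A, φ (f x) = b) (hB' : ∀ x ∈ B, φ (f x) = !b) : canDistribute c xs A B = true := by
  induction xs generalizing A B with
  | nil => rfl
  | cons x xs ih =>
    have hx := hxs x (by simp)
    have hxs' : ∀ y ∈ xs, y ∈ vs := fun y hy => hxs y (by simp [hy])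
    rw [canDistribute, Bool.or_eq_true, Bool.and_eq_true, Bool.and_eq_true]
    by_cases h : φ (f x) = b
    · refine Or.inl ⟨fits_eq_true hφ hx hA hf fun y hy => (hA' y hy).trans h.symm,
        ih _ _ hxs' ?_ hB ?_ hB'⟩
      · simpa [hx] using hA
      · simpa [h] using hA'
    · have h : φ (f x) = !b := by
        cases h1 : φ (f x) <;> cases h2 : b <;> simp_all
      refine Or.inr ⟨fits_eq_true hφ hx hB hf fun y hy => (hB' y hy).trans h.symm,
        ih _ _ hxs' hA ?_ hA' ?_⟩
      · simpa [hx] using hB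
      · simpa [h] using hB'

end

/-! ### Patterns and their refutations -/

/-- Partial information about a digraph on the vertices `0, …, size - 1`, where `size ≤ 8`: the
codes of a set of arcs that are present and of a set of arcs that are absent. -/
structure Pattern where
  size : ℕ
  arcs : ℕ
  nonArcs : ℕ
  deriving DecidableEq

/-- The first `P.size` values of `f` are distinct vertices of `D` that match the pattern. The other
values are irrelevant. -/
structure Pattern.Realizes (P : Pattern) (D : Digraph V) (f : ℕ → V) : Prop where
  injOn : ∀ i < P.size, ∀ j < P.size, f i = f j → i = j
  adj : ∀ i < P.size, ∀ j < P.size, hasBit P.arcs i j → D.Adj (f i) (f j)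
  not_adj : ∀ i < P.size, ∀ j < P.size, hasBit P.nonArcs i j → ¬ D.Adj (f i) (f j)

/-- The numbers below `n` that are not in `l`, in decreasing order. -/
def others (n : ℕ) (l : List ℕ) : List ℕ := (List.range n).reverse.filter fun x => !l.contains x

/-- Among the first `n` vertices, the reversal of the arc `uv` leaves a good colouring with `u` and
`v` in the same class. -/
def hasColouring (n c u v : ℕ) : Bool :=
  canDistribute (revCode c u v) (others n [u, v]) [u, v] []

/-- Some vertex `w < n` can complete `uv` to a directed triangle inside the class of `u` and `v` in
a good colouring for the reversal of `uv`. -/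
def mayBeWitnessed (n c d u v : ℕ) : Bool :=
  (List.range n).any fun w => !hasBit d v w && (!hasBit d w u && (fits (revCode c u v) w [u, v] &&
    canDistribute (revCode c u v) (others n [u, v, w]) [u, v, w] []))

/-- The map `p` embeds the pattern `P` into the pattern `Q`. -/
def embeds (P Q : Pattern) (p : ℕ → ℕ) : Bool :=
  (List.range P.size).all fun i => decide (p i < Q.size) && (List.range P.size).all fun j =>
    (!decide (p i = p j) || decide (i = j)) &&
    ((!hasBit P.arcs i j || hasBit Q.arcs (p i) (p j)) &&
    (!hasBit P.nonArcs i j || hasBit Q.nonArcs (p i) (p j)))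

/-- The colouring of `0, …, n - 1` by the binary digits of `m` has no monochromatic digon or
triangle with respect to `r`. -/
def isGoodMask (n : ℕ) (r : ℕ → ℕ → Bool) (m : ℕ) : Bool :=
  (List.range n).all fun x => (List.range n).all fun y =>
    !(m.testBit x == m.testBit y) || (!r x y || (!r y x &&
      (List.range n).all fun z => !(m.testBit z == m.testBit x) || (!r y z || !r z x)))

/-- No arc of the code `c` joins the vertex `n` to a vertex up to `n`. -/
def isIsolated (n c : ℕ) : Bool :=
  (List.range (n + 1)).all fun i => !hasBit c i n && !hasBit c n i

/-- A proof tree showing that a pattern does not occur in a critical semicomplete digraph.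
* `kill u v`: there is no colouring for the arc `uv`.
* `goto k p`: the map `p` embeds the `k`-th pattern that is known not to occur.
* `ask x y yes no`: the arc `xy` is either present or absent; in the second case `yx` is present.
* `witness u v t`: no vertex so far witnesses the simple arc `uv`, so the witness is a new vertex.
* `fresh m t`: the colouring `m` is good, so the digraph has a further vertex. -/
inductive Refutation
  | kill (u v : ℕ)
  | goto (k : ℕ) (p : List ℕ)
  | ask (x y : ℕ) (yes no : Refutation)
  | witness (u v : ℕ) (t : Refutation)
  | fresh (m : ℕ) (t : Refutation)

namespace Refutation

/-- Check that a proof tree refutes the pattern with `n` vertices, arcs `a` and absent arcs `d`. -/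
def check (known : List Pattern) : Refutation → ℕ → ℕ → ℕ → Bool
  | kill u v, n, a, _ =>
    decide (n ≤ 8) && (decide (u < n) && (decide (v < n) &&
      (hasBit a u v && !hasColouring n a u v)))
  | goto k p, n, a, d =>
    match known[k]? with
    | none => false
    | some P => embeds P ⟨n, a, d⟩ fun i => p.getD i 0
  | ask x y t s, n, a, d =>
    decide (n ≤ 8) && (decide (x < n) && (decide (y < n) && (!decide (x = y) &&
      (t.check known n (a ||| arcBit x y) d &&
        s.check known n (a ||| arcBit y x) (d ||| arcBit x y)))))
  | witness u v t, n, a, d =>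
    decide (n < 8) && (isIsolated n a && (isIsolated n d && (decide (u < n) && (decide (v < n) &&
      (hasBit a u v && (hasBit d v u && (!mayBeWitnessed n a d u v &&
        t.check known (n + 1) (a ||| arcBit v n ||| arcBit n u) d)))))))
  | fresh m t, n, a, d =>
    decide (n < 8) && (isIsolated n a && (isIsolated n d &&
      (isGoodMask n (fun x y => !decide (x = y) && !hasBit d x y) m && t.check known (n + 1) a d)))

end Refutation

/-- Check a list of refutations, each of which may use the patterns refuted before it. -/
def checkAll : List Pattern → List (Pattern × Refutation) → Bool
  | _, [] => true
  | known, (P, t) :: l =>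
    t.check known P.size P.arcs P.nonArcs && checkAll (known ++ [P]) l

/-- The pattern of all induced copies of the digraph with code `a`: every arc between distinct
vertices that is not in `a` is absent. -/
def Pattern.induced (n a : ℕ) : Pattern where
  size := n
  arcs := a
  nonArcs := a ^^^ (List.range n).foldr (fun i s => s + (2 ^ n - 1 - 2 ^ i) * 2 ^ (8 * i)) 0

/-! ### Soundness of the refutations -/

section

variable {D : Digraph V} {f : ℕ → V} {n a d : ℕ}

theorem mem_others {l : List ℕ} {x : ℕ} : x ∈ others n l ↔ x < n ∧ x ∉ l := by
  simp [others]

/-- Here `g` numbers the vertices and `r` is an upper bound for the adjacency. -/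
theorem isGood_of_isGoodMask {r : ℕ → ℕ → Bool} {m : ℕ} {g : V → ℕ} (hg : ∀ x, g x < n)
    (hr : ∀ x y, D.Adj x y → r (g x) (g y) = true) (hm : isGoodMask n r m = true) :
    D.IsGood fun x => m.testBit (g x) := by
  intro x y hxy hc
  simp only [isGoodMask, List.all_eq_true, List.mem_range, Bool.or_eq_true, Bool.and_eq_true,
    Bool.not_eq_true', beq_eq_false_iff_ne] at hm
  have hr' : ∀ x y, r (g x) (g y) = false → ¬ D.Adj x y := fun x y h h' => by
    rw [hr x y h'] at h
    exact Bool.noConfusion h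
  rcases hm _ (hg x) _ (hg y) with h1 | h1 | ⟨h1, h2⟩
  · exact absurd hc h1
  · exact absurd hxy (hr' _ _ h1)
  · refine ⟨hr' _ _ h1, fun z hz hyz hzx => ?_⟩
    rcases h2 _ (hg z) with h3 | h3 | h3
    · exact h3 hz
    · exact hr' _ _ h3 hyz
    · exact hr' _ _ h3 hzx

namespace Pattern.Realizes

theorem reverseArc_adj (h : Realizes ⟨n, a, d⟩ D f) (hn : n ≤ 8) {u v : ℕ} (hu : u < n)
    (hv : v < n) : ∀ i ∈ List.range n, ∀ j ∈ List.range n, hasBit (revCode a u v) i j →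
      (D.reverseArc (f u) (f v)).Adj (f i) (f j) := by
  intro i hi j hj hij
  rw [List.mem_range] at hi hj
  rw [hasBit_revCode (by omega) (by omega) (by omega)] at hij
  simp only [Bool.or_eq_true, Bool.and_eq_true, Bool.not_eq_true', Bool.and_eq_false_iff,
    decide_eq_true_eq, decide_eq_false_iff_not] at hij
  rcases hij with ⟨h1, h2⟩ | ⟨rfl, rfl⟩
  · refine Or.inl ⟨h.adj i hi j hj h1, fun h3 => ?_⟩
    have h4 := h.injOn i hi u hu h3.1
    have h5 := h.injOn j hj v hv h3.2
    tauto
  · exact Or.inr ⟨rfl, rfl⟩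

theorem hasColouring (h : Realizes ⟨n, a, d⟩ D f) (hD : D.IsCritical) (hn : n ≤ 8) {u v : ℕ}
    (hu : u < n) (hv : v < n) (huv : hasBit a u v) : Digraph.hasColouring n a u v = true := by
  obtain ⟨φ, hc, hφ⟩ := hD.good _ _ (h.adj u hu v hv huv)
  refine canDistribute_eq_true hφ (h.reverseArc_adj hn hu hv) _ _ _ (φ (f u)) ?_ ?_ ?_ ?_ ?_ <;>
    simp +contextual [mem_others, hu, hv, hc]

theorem mayBeWitnessed (h : Realizes ⟨n, a, d⟩ D f) (hn : n ≤ 8) {u v w : ℕ} {φ : V → Bool}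
    (hu : u < n) (hv : v < n) (hw : w < n) (hc : φ (f u) = φ (f v))
    (hφ : (D.reverseArc (f u) (f v)).IsGood φ) (hcw : φ (f w) = φ (f u))
    (hvw : D.Adj (f v) (f w)) (hwu : D.Adj (f w) (f u)) :
    Digraph.mayBeWitnessed n a d u v = true := by
  simp only [Digraph.mayBeWitnessed, List.any_eq_true, Bool.and_eq_true, Bool.not_eq_true']
  refine ⟨w, by simpa using hw, ?_, ?_, ?_, ?_⟩
  · exact Bool.eq_false_iff.2 fun h' => h.not_adj v hv w hw h' hvw
  · exact Bool.eq_false_iff.2 fun h' => h.not_adj w hw u hu h' hwu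
  · refine fits_eq_true hφ (vs := List.range n) ?_ ?_ (h.reverseArc_adj hn hu hv) ?_ <;>
      simp +contextual [hu, hv, hw, hc, hcw]
  · refine canDistribute_eq_true hφ (h.reverseArc_adj hn hu hv) _ _ _ (φ (f u)) ?_ ?_ ?_ ?_ ?_ <;>
      simp +contextual [mem_others, hu, hv, hw, hc, hcw]

theorem of_embeds {P Q : Pattern} {p : ℕ → ℕ} (hp : embeds P Q p = true) (h : Q.Realizes D f) :
    P.Realizes D (fun i => f (p i)) := by
  simp only [embeds, List.all_eq_true, List.mem_range, Bool.and_eq_true, decide_eq_true_eq,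
    Bool.or_eq_true, Bool.not_eq_true', decide_eq_false_iff_not] at hp
  refine ⟨fun i hi j hj hij => ?_, fun i hi j hj hij => ?_, fun i hi j hj hij => ?_⟩
  · have := ((hp i hi).2 j hj).1
    have := h.injOn _ (hp i hi).1 _ (hp j hj).1 hij
    tauto
  · refine h.adj _ (hp i hi).1 _ (hp j hj).1 ?_
    have := ((hp i hi).2 j hj).2.1
    simp_all
  · refine h.not_adj _ (hp i hi).1 _ (hp j hj).1 ?_
    have := ((hp i hi).2 j hj).2.2
    simp_all

theorem add_arc (h : Realizes ⟨n, a, d⟩ D f) (hn : n ≤ 8) {x y : ℕ} (hy : y < n)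
    (hxy : D.Adj (f x) (f y)) : Realizes ⟨n, a ||| arcBit x y, d⟩ D f := by
  refine ⟨h.injOn, fun i hi j hj hij => ?_, h.not_adj⟩
  have hj' : j < n := hj
  rw [hasBit_lor_arcBit (by omega) (by omega)] at hij
  simp only [Bool.or_eq_true, Bool.and_eq_true, decide_eq_true_eq] at hij
  rcases hij with hij | ⟨rfl, rfl⟩
  · exact h.adj i hi j hj hij
  · exact hxy

theorem add_nonArc (h : Realizes ⟨n, a, d⟩ D f) (hn : n ≤ 8) {x y : ℕ} (hy : y < n)
    (hxy : ¬ D.Adj (f x) (f y)) : Realizes ⟨n, a, d ||| arcBit x y⟩ D f := by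
  refine ⟨h.injOn, h.adj, fun i hi j hj hij => ?_⟩
  have hj' : j < n := hj
  rw [hasBit_lor_arcBit (by omega) (by omega)] at hij
  simp only [Bool.or_eq_true, Bool.and_eq_true, decide_eq_true_eq] at hij
  rcases hij with hij | ⟨rfl, rfl⟩
  · exact h.not_adj i hi j hj hij
  · exact hxy

theorem add_vertex (h : Realizes ⟨n, a, d⟩ D f) (ha : isIsolated n a = true)
    (hd : isIsolated n d = true) {w : V} (hw : ∀ i < n, f i ≠ w) :
    Realizes ⟨n + 1, a, d⟩ D (Function.update f n w) := by
  simp only [isIsolated, List.all_eq_true, List.mem_range, Bool.and_eq_true,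
    Bool.not_eq_true'] at ha hd
  have hup : ∀ i < n, Function.update f n w i = f i := fun i hi =>
    Function.update_of_ne (by omega) _ _
  refine ⟨fun i hi j hj hij => ?_, fun i hi j hj hij => ?_, fun i hi j hj hij => ?_⟩ <;>
    replace hi : i < n + 1 := hi <;> replace hj : j < n + 1 := hj <;>
    rcases Nat.lt_succ_iff_lt_or_eq.1 hi with hi' | rfl <;>
    rcases Nat.lt_succ_iff_lt_or_eq.1 hj with hj' | rfl
  · rw [hup i hi', hup j hj'] at hij
    exact h.injOn i hi' j hj' hij
  · rw [hup i hi', Function.update_self] at hij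
    exact absurd hij (hw i hi')
  · rw [hup j hj', Function.update_self] at hij
    exact absurd hij.symm (hw j hj')
  · rfl
  · rw [hup i hi', hup j hj']
    exact h.adj i hi' j hj' hij
  · simp_all
  · simp_all
  · simp_all
  · rw [hup i hi', hup j hj']
    exact h.not_adj i hi' j hj' hij
  · simp_all
  · simp_all
  · simp_all

end Pattern.Realizes

/-- The pattern does not occur in `D`. -/
def Pattern.Excluded (P : Pattern) (D : Digraph V) : Prop := ∀ f, ¬ P.Realizes D f

theorem Refutation.excluded_of_check (hl : D.IsLoopless) (hs : D.IsSemicomplete)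
    (hD : D.IsCritical) {known : List Pattern} (hknown : ∀ P ∈ known, P.Excluded D)
    (t : Refutation) (n a d : ℕ) (ht : t.check known n a d = true) :
    Pattern.Excluded ⟨n, a, d⟩ D := by
  induction t generalizing n a d with
  | kill u v =>
    intro f h
    simp only [check, Bool.and_eq_true, decide_eq_true_eq, Bool.not_eq_true'] at ht
    obtain ⟨hn, hu, hv, huv, ht⟩ := ht
    rw [h.hasColouring hD hn hu hv huv] at ht
    exact Bool.noConfusion ht
  | goto k p =>
    intro f h
    simp only [check] at ht
    split at ht
    · exact Bool.noConfusion ht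
    · rename_i P hP
      exact hknown P (List.mem_of_getElem? hP) _ (h.of_embeds ht)
  | ask x y t s iht ihs =>
    intro f h
    simp only [check, Bool.and_eq_true, decide_eq_true_eq, Bool.not_eq_true',
      decide_eq_false_iff_not] at ht
    obtain ⟨hn, hx, hy, hne, h1, h2⟩ := ht
    by_cases hxy : D.Adj (f x) (f y)
    · exact iht _ _ _ h1 f (h.add_arc hn hy hxy)
    · have hyx : D.Adj (f y) (f x) :=
        (hs (f x) (f y) fun he => hne (h.injOn x hx y hy he)).resolve_left hxy
      exact ihs _ _ _ h2 f ((h.add_arc hn hx hyx).add_nonArc hn hy hxy)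
  | witness u v t ih =>
    intro f h
    simp only [check, Bool.and_eq_true, decide_eq_true_eq, Bool.not_eq_true'] at ht
    obtain ⟨hn, ha, hd, hu, hv, huv, hvu, hw, ht⟩ := ht
    obtain ⟨φ, hc, hφ, w, hcw, hvw, hwu⟩ := hD.exists_witness (h.adj u hu v hv huv)
      (h.not_adj v hv u hu hvu)
    have hnew : ∀ i < n, f i ≠ w := by
      rintro i hi rfl
      rw [h.mayBeWitnessed hn.le hu hv hi hc hφ hcw hvw hwu] at hw
      exact Bool.noConfusion hw
    refine ih _ _ _ ht _ (((h.add_vertex ha hd hnew).add_arc hn (by omega) ?_).add_arc hn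
      (by omega) ?_)
    · rwa [Function.update_self, Function.update_of_ne (by omega)]
    · rwa [Function.update_self, Function.update_of_ne (by omega)]
  | fresh m t ih =>
    intro f h
    simp only [check, Bool.and_eq_true, decide_eq_true_eq] at ht
    obtain ⟨hn, ha, hd, hm, ht⟩ := ht
    obtain ⟨w, hw⟩ : ∃ w, ∀ i < n, f i ≠ w := by
      by_contra hcon
      push Not at hcon
      choose g hg hfg using hcon
      refine hD.not_good _ (isGood_of_isGoodMask hg (fun x y hxy => ?_) hm)
      simp only [Bool.and_eq_true, Bool.not_eq_true', decide_eq_false_iff_not]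
      refine ⟨fun he => ?_, Bool.eq_false_iff.2 fun hd => h.not_adj _ (hg x) _ (hg y) hd ?_⟩
      · rw [← hfg x, he, hfg] at hxy
        exact hl _ hxy
      · rwa [hfg, hfg]
    exact ih _ _ _ ht _ (h.add_vertex ha hd hw)

theorem excluded_of_checkAll (hl : D.IsLoopless) (hs : D.IsSemicomplete) (hD : D.IsCritical)
    (l : List (Pattern × Refutation)) (known : List Pattern) (hknown : ∀ P ∈ known, P.Excluded D)
    (h : checkAll known l = true) : ∀ p ∈ l, p.1.Excluded D := by
  induction l generalizing known with
  | nil => simp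
  | cons p l ih =>
    obtain ⟨P, t⟩ := p
    rw [checkAll, Bool.and_eq_true] at h
    have hP : P.Excluded D := t.excluded_of_check hl hs hD hknown _ _ _ h.1
    have := ih (known ++ [P]) (by simpa [or_imp, forall_and] using ⟨hknown, hP⟩) h.2
    simpa using ⟨hP, by simpa using this⟩

end

/-! ### The search -/

/-- Number of vertices and code of each of the eight digraphs, in the order of `eightDigraphs`. -/
def dicriticalCodes : Fin 8 → ℕ × ℕ :=
  ![(3, 0x030506), (4, 0x07090c0a), (5, 0x0311180d16), (5,
    0x0314180d0e), (6, 0x032430281d1e), (6, 0x072830191c1a), (7, 0x07486050393c3a), (7,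
    0x0b456231582c16)]

/-- Patterns that do not occur in a critical semicomplete digraph containing none of the eight
digraphs, each with its proof tree. The numbers below eight in `goto` refer to the eight digraphs,
larger ones to earlier entries. The entries include the digon and, last, the induced directed
triangle. -/
def refutations : List (Pattern × Refutation) := [
  (.induced 5 0x0e13090512, .witness 4 1 (.ask 5 0 (.ask 5 3 (.kill 5 0) (.kill 3 0)) (.ask 5 2
    (.kill 3 4) (.kill 2 5)))),
  (.induced 6 0x110c23293512, .witness 1 5 (.ask 6 4 (.kill 6 4) (.ask 6 0 (.kill 2 0) (.kill 5
    6)))),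
  (.induced 6 0x150c23093512, .witness 5 0 (.ask 6 3 (.ask 6 1 (.kill 6 5) (.kill 1 2)) (.kill 3
    6))),
  (.induced 5 0x0c03091512, .fresh 9 (.ask 0 5 (.ask 5 3 (.ask 5 1 (.ask 5 2 (.kill 5 2) (.ask 5 4
    (.kill 5 4) (.kill 2 5))) (.ask 5 4 (.ask 5 2 (.kill 5 2) (.kill 2 0)) (.kill 1 5))) (.kill 3
    5)) (.ask 5 3 (.kill 5 0) (.ask 5 1 (.ask 5 4 (.kill 5 4) (.ask 5 2 (.kill 1 2) (.kill 2 5)))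
    (.ask 4 5 (.kill 1 5) (.ask 5 2 (.ask 2 5 (.kill 1 0) (.goto 10 [0, 1, 2, 3, 4, 5])) (.goto 9
    [0, 1, 2, 3, 4, 5]))))))),
  (.induced 5 0x0613190512, .witness 3 4 (.ask 5 0 (.ask 5 2 (.kill 5 0) (.kill 2 0)) (.ask 5 1
    (.kill 0 1) (.kill 4 5)))),
  (.induced 5 0x0e03190512, .witness 4 1 (.ask 5 0 (.ask 5 2 (.kill 5 0) (.kill 2 0)) (.ask 5 3
    (.kill 2 4) (.kill 3 5)))),
  (.induced 6 0x110e23292512, .witness 2 5 (.ask 6 0 (.ask 6 3 (.kill 6 0) (.kill 3 0)) (.kill 5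
    6))),
  (.induced 6 0x150e23092512, .witness 5 0 (.ask 6 3 (.ask 6 2 (.kill 6 5) (.kill 1 0)) (.ask 6 1
    (.kill 3 1) (.kill 3 6)))),
  (.induced 5 0x0e03090512, .witness 4 1 (.ask 0 5 (.ask 5 2 (.ask 5 3 (.kill 4 2) (.kill 3 5))
    (.kill 2 5)) (.ask 5 1 (.kill 5 1) (.ask 5 3 (.ask 5 2 (.kill 5 0) (.kill 2 0)) (.ask 4 5
    (.kill 4 5) (.ask 5 2 (.ask 2 5 (.kill 3 0) (.goto 15 [0, 1, 2, 3, 4, 5])) (.goto 14 [0, 1, 2,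
    3, 4, 5]))))))),
  (.induced 5 0x0613090512, .witness 3 4 (.ask 5 0 (.ask 5 2 (.kill 5 0) (.ask 5 1 (.kill 3 1)
    (.kill 2 0))) (.ask 1 5 (.kill 4 5) (.ask 5 2 (.kill 4 1) (.ask 3 5 (.kill 3 5) (.goto 16 [1,
    0, 5, 3, 2])))))),
  (.induced 4 0x03090502, .witness 2 0 (.ask 4 0 (.ask 4 1 (.kill 4 2) (.kill 1 2)) (.ask 1 4
    (.ask 3 4 (.kill 3 4) (.ask 2 4 (.kill 2 0) (.ask 4 1 (.goto 2 [1, 4, 2, 3, 0]) (.goto 11 [0,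
    1, 2, 3, 4])))) (.ask 2 4 (.ask 4 3 (.ask 3 4 (.kill 2 0) (.goto 13 [0, 1, 2, 3, 4])) (.goto
    12 [0, 1, 2, 3, 4])) (.ask 4 3 (.ask 3 4 (.goto 8 [0, 1, 2, 3, 4]) (.goto 16 [0, 1, 2, 3, 4]))
    (.goto 17 [0, 1, 2, 3, 4])))))),
  (.induced 5 0x071209150a, .witness 4 2 (.ask 5 0 (.kill 5 0) (.kill 2 5))),
  (.induced 6 0x06253209152a, .witness 3 5 (.ask 6 2 (.ask 6 0 (.kill 6 0) (.kill 0 1)) (.ask 6 1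
    (.kill 0 1) (.kill 1 6)))),
  (.induced 5 0x051209150a, .witness 1 4 (.ask 0 5 (.ask 1 5 (.kill 4 5) (.ask 2 5 (.kill 2 5)
    (.ask 5 0 (.kill 5 2) (.ask 5 4 (.kill 5 4) (.ask 5 3 (.ask 3 5 (.kill 0 1) (.goto 20 [1, 0,
    3, 4, 5, 2])) (.goto 20 [0, 1, 2, 3, 4, 5])))))) (.ask 1 5 (.kill 4 0) (.ask 5 4 (.ask 5 3
    (.kill 5 1) (.kill 1 0)) (.goto 18 [0, 1, 4, 5]))))),
  (.induced 5 0x011219150a, .witness 1 4 (.ask 2 5 (.ask 5 0 (.kill 2 0) (.kill 2 5)) (.ask 1 5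
    (.kill 1 0) (.ask 5 4 (.kill 5 4) (.ask 5 0 (.ask 0 5 (.kill 2 0) (.goto 18 [0, 1, 4, 5]))
    (.goto 21 [0, 1, 4, 5, 2])))))),
  (.induced 4 0x0209050a, .witness 0 3 (.ask 0 4 (.ask 4 1 (.kill 3 1) (.kill 3 4)) (.ask 4 2
    (.ask 4 3 (.kill 4 0) (.ask 1 4 (.ask 2 4 (.kill 1 0) (.ask 4 1 (.goto 19 [0, 1, 2, 3, 4])
    (.goto 21 [0, 1, 2, 3, 4]))) (.goto 18 [1, 0, 3, 4]))) (.ask 4 1 (.ask 1 4 (.kill 2 0) (.goto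
    18 [0, 1, 2, 4])) (.ask 4 3 (.goto 12 [4, 3, 1, 2, 0]) (.goto 22 [0, 1, 2, 3, 4])))))),
  (.induced 4 0x07090502, .witness 2 0 (.ask 1 4 (.ask 4 3 (.kill 1 2) (.kill 3 4)) (.ask 4 0
    (.kill 4 2) (.ask 3 4 (.kill 3 1) (.goto 18 [1, 0, 4, 3]))))),
  (.induced 4 0x0609050a, .witness 0 3 (.ask 0 4 (.ask 4 1 (.kill 3 1) (.kill 3 4)) (.ask 4 3
    (.ask 4 2 (.kill 4 0) (.kill 2 0)) (.ask 4 1 (.ask 1 4 (.kill 1 2) (.goto 18 [1, 0, 3, 4]))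
    (.goto 23 [1, 0, 3, 4]))))),
  (.induced 4 0x0309050a, .witness 2 0 (.ask 4 0 (.kill 4 0) (.ask 2 4 (.kill 0 4) (.ask 1 4 (.ask
    3 4 (.kill 3 4) (.goto 18 [3, 0, 4, 2])) (.goto 23 [1, 0, 4, 2]))))),
  (.induced 3 0x010502, .witness 1 2 (.ask 3 0 (.ask 1 3 (.kill 2 0) (.ask 0 3 (.ask 3 2 (.kill 3
    2) (.goto 26 [0, 1, 2, 3])) (.ask 3 2 (.goto 24 [0, 1, 2, 3]) (.goto 18 [0, 1, 2, 3])))) (.ask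
    1 3 (.kill 2 3) (.ask 3 2 (.goto 25 [0, 1, 2, 3]) (.goto 23 [0, 1, 2, 3]))))),
  (.induced 3 0x010506, .witness 1 2 (.ask 1 3 (.kill 1 3) (.ask 3 0 (.ask 3 2 (.kill 3 1) (.ask 0
    3 (.goto 1 [1, 2, 3, 0]) (.goto 26 [0, 2, 3, 1]))) (.goto 27 [1, 0, 3])))),
  (.induced 5 0x0c03081516, .witness 4 2 (.ask 5 0 (.ask 5 1 (.kill 5 4) (.ask 0 5 (.kill 1 4)
    (.goto 27 [0, 1, 5]))) (.ask 5 1 (.ask 1 5 (.kill 0 4) (.goto 27 [1, 0, 5])) (.ask 5 2 (.kill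
    5 2) (.ask 3 5 (.kill 3 5) (.ask 4 5 (.kill 0 2) (.goto 4 [0, 1, 4, 2, 5, 3]))))))),
  (.induced 5 0x0313180506, .witness 3 4 (.ask 0 5 (.ask 1 5 (.kill 4 5) (.ask 5 0 (.kill 4 1)
    (.goto 27 [1, 0, 5]))) (.ask 5 1 (.ask 1 5 (.kill 4 0) (.ask 5 2 (.kill 5 2) (.ask 3 5 (.kill
    2 4) (.ask 5 4 (.kill 2 3) (.goto 5 [3, 4, 5, 0, 1, 2]))))) (.goto 27 [0, 1, 5])))),
  (.induced 4 0x03080506, .fresh 5 (.ask 4 0 (.ask 4 1 (.ask 4 2 (.kill 4 2) (.ask 0 4 (.goto 27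
    [4, 0, 2]) (.ask 1 4 (.goto 27 [4, 1, 2]) (.ask 4 3 (.ask 3 4 (.goto 3 [3, 4, 0, 1, 2]) (.goto
    30 [0, 1, 2, 4, 3])) (.goto 30 [0, 1, 2, 3, 4]))))) (.ask 0 4 (.goto 28 [0, 1, 4]) (.goto 27
    [0, 1, 4]))) (.ask 4 1 (.ask 1 4 (.goto 28 [1, 0, 4]) (.goto 27 [1, 0, 4])) (.ask 3 4 (.kill 3
    4) (.ask 4 2 (.ask 2 4 (.goto 3 [0, 1, 2, 4, 3]) (.goto 29 [0, 1, 2, 3, 4])) (.goto 29 [0, 1,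
    4, 3, 2])))))),
  (.induced 3 0x000506, .witness 1 2 (.ask 1 3 (.ask 3 2 (.kill 0 2) (.goto 27 [3, 1, 2])) (.ask 3
    0 (.ask 0 3 (.goto 28 [0, 3, 1]) (.ask 3 2 (.kill 3 2) (.goto 31 [0, 1, 2, 3]))) (.goto 27 [1,
    0, 3])))),
  (.induced 3 0x030102, .witness 2 0 (.ask 3 0 (.ask 2 3 (.kill 2 1) (.goto 27 [0, 3, 2])) (.ask 3
    1 (.ask 1 3 (.goto 28 [1, 0, 3]) (.goto 27 [1, 0, 3])) (.goto 32 [0, 1, 3])))),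
  (.induced 2 0x0102, .fresh 1 (.ask 2 0 (.ask 0 2 (.ask 2 1 (.ask 1 2 (.goto 0 [0, 1, 2]) (.goto
    28 [0, 2, 1])) (.goto 28 [0, 1, 2])) (.ask 2 1 (.ask 1 2 (.goto 28 [1, 2, 0]) (.goto 33 [0, 1,
    2])) (.goto 27 [0, 1, 2]))) (.ask 2 1 (.ask 1 2 (.goto 28 [1, 0, 2]) (.goto 27 [1, 0, 2]))
    (.goto 32 [0, 1, 2])))),
  (.induced 6 0x150330192c0a, .witness 2 4 (.ask 6 1 (.ask 6 3 (.kill 6 3) (.ask 6 5 (.ask 6 0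
    (.kill 6 0) (.kill 1 5)) (.kill 5 6))) (.ask 6 0 (.kill 5 0) (.ask 6 3 (.kill 1 3) (.kill 1
    6))))),
  (.induced 7 0x2a174330590c4a, .witness 2 0 (.ask 7 1 (.ask 7 3 (.kill 7 3) (.kill 0 1)) (.ask 7
    6 (.kill 0 3) (.ask 7 4 (.kill 2 0) (.kill 0 7))))),
  (.induced 6 0x170330190c0a, .witness 5 4 (.ask 6 2 (.ask 6 1 (.ask 6 3 (.kill 6 3) (.kill 5 1))
    (.kill 5 0)) (.ask 3 6 (.kill 2 6) (.ask 6 0 (.kill 2 0) (.ask 1 6 (.kill 5 0) (.ask 6 4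
    (.kill 6 4) (.ask 5 6 (.kill 5 0) (.goto 36 [0, 1, 2, 3, 4, 5, 6])))))))),
  (.induced 7 0x29056330596c0a, .witness 1 6 (.ask 7 5 (.ask 7 4 (.kill 7 5) (.kill 4 5)) (.ask 7
    0 (.kill 6 0) (.ask 7 2 (.kill 1 3) (.kill 6 7))))),
  (.induced 6 0x052330192c0a, .fresh 13 (.ask 6 0 (.ask 0 6 (.goto 34 [0, 6]) (.ask 6 2 (.ask 6 4
    (.kill 6 0) (.ask 6 5 (.kill 6 0) (.ask 6 1 (.kill 4 0) (.ask 3 6 (.kill 1 6) (.goto 37 [6, 0,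
    1, 3, 5, 4]))))) (.ask 6 1 (.ask 6 3 (.kill 6 3) (.ask 6 4 (.kill 2 4) (.kill 2 6))) (.ask 5 6
    (.kill 1 6) (.ask 6 3 (.ask 3 6 (.kill 1 5) (.ask 6 4 (.kill 6 5) (.goto 38 [0, 1, 2, 3, 4, 5,
    6]))) (.goto 37 [6, 5, 2, 0, 3, 1])))))) (.ask 6 2 (.ask 1 6 (.ask 6 3 (.kill 1 3) (.ask 6 5
    (.kill 1 5) (.kill 1 6))) (.ask 6 3 (.kill 6 3) (.ask 2 6 (.kill 2 6) (.ask 4 6 (.ask 6 5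
    (.kill 4 5) (.kill 4 6)) (.ask 6 5 (.kill 6 5) (.goto 7 [2, 4, 0, 1, 3, 5, 6])))))) (.ask 3 6
    (.kill 2 6) (.ask 6 4 (.kill 2 3) (.ask 5 6 (.kill 4 6) (.goto 37 [6, 3, 4, 5, 0, 2]))))))),
  (.induced 6 0x042330192c2a, .witness 1 5 (.ask 6 2 (.ask 6 3 (.kill 6 3) (.ask 6 4 (.kill 0 5)
    (.kill 4 5))) (.ask 1 6 (.kill 1 6) (.ask 6 4 (.kill 0 5) (.ask 3 6 (.kill 2 6) (.ask 6 5
    (.kill 0 5) (.goto 39 [3, 4, 1, 5, 2, 6]))))))),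
  (.induced 6 0x072330190c0a, .witness 5 0 (.ask 6 2 (.ask 6 3 (.kill 6 3) (.ask 6 1 (.kill 6 1)
    (.ask 6 4 (.kill 6 4) (.kill 4 6)))) (.ask 6 3 (.ask 6 4 (.kill 2 3) (.kill 4 1)) (.kill 2
    6)))),
  (.induced 5 0x0310190c0a, .witness 2 3 (.ask 2 5 (.goto 34 [2, 5]) (.ask 5 3 (.goto 27 [3, 5,
    2]) (.ask 5 0 (.ask 0 5 (.goto 23 [0, 5, 2, 3]) (.ask 5 1 (.ask 1 5 (.goto 23 [1, 5, 0, 3])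
    (.ask 5 4 (.ask 4 5 (.kill 2 4) (.goto 37 [0, 1, 2, 3, 4, 5])) (.goto 41 [0, 1, 2, 3, 4, 5])))
    (.ask 5 4 (.ask 4 5 (.kill 2 0) (.goto 35 [0, 1, 2, 3, 4, 5])) (.goto 39 [0, 1, 2, 3, 4,
    5])))) (.ask 5 1 (.ask 1 5 (.goto 27 [5, 1, 3]) (.ask 5 4 (.ask 4 5 (.kill 0 1) (.goto 39 [1,
    2, 0, 3, 5, 4])) (.goto 35 [1, 2, 0, 3, 5, 4]))) (.ask 5 4 (.ask 4 5 (.kill 0 5) (.goto 41 [3,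
    5, 2, 4, 0, 1])) (.goto 40 [0, 1, 2, 3, 4, 5]))))))),
  (.induced 5 0x0110191c0a, .witness 2 3 (.ask 2 5 (.goto 34 [2, 5]) (.ask 5 3 (.goto 27 [3, 5,
    2]) (.ask 5 0 (.ask 0 5 (.goto 23 [0, 5, 2, 3]) (.ask 5 4 (.ask 1 5 (.kill 1 4) (.ask 4 5
    (.kill 1 4) (.goto 42 [1, 3, 5, 4, 0]))) (.goto 42 [4, 5, 2, 0, 3]))) (.ask 5 1 (.ask 1 5
    (.kill 1 4) (.goto 42 [1, 2, 0, 3, 5])) (.ask 5 4 (.kill 1 4) (.goto 42 [4, 0, 1, 5, 2]))))))),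
  (.induced 6 0x0b2710290c0a, .witness 4 0 (.ask 6 0 (.goto 34 [0, 6]) (.ask 6 3 (.ask 6 1 (.ask 6
    5 (.ask 6 2 (.kill 6 3) (.kill 2 3)) (.kill 5 3)) (.kill 0 3)) (.ask 6 2 (.kill 5 3) (.ask 1 6
    (.ask 6 5 (.kill 4 0) (.kill 5 6)) (.goto 43 [1, 2, 0, 3, 6])))))),
  (.induced 6 0x180710292c2a, .witness 5 3 (.ask 6 3 (.kill 6 3) (.ask 5 6 (.kill 3 6) (.ask 6 0
    (.ask 6 4 (.kill 6 0) (.ask 6 1 (.ask 6 2 (.kill 6 5) (.kill 4 0)) (.goto 42 [3, 4, 1, 6,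
    5]))) (.ask 6 4 (.ask 6 1 (.kill 6 1) (.ask 6 2 (.kill 1 3) (.ask 4 6 (.kill 1 6) (.goto 6 [0,
    1, 2, 5, 3, 6, 4])))) (.goto 42 [3, 4, 0, 6, 5])))))),
  (.induced 6 0x072730090c0a, .witness 4 5 (.ask 4 6 (.kill 4 6) (.ask 6 5 (.kill 6 4) (.ask 0 6
    (.ask 3 6 (.kill 0 6) (.ask 1 6 (.ask 6 2 (.kill 1 3) (.kill 5 6)) (.goto 42 [4, 5, 6, 1,
    3]))) (.ask 6 3 (.ask 3 6 (.kill 6 0) (.goto 42 [4, 5, 6, 0, 3])) (.ask 1 6 (.kill 1 6) (.goto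
    45 [4, 5, 6, 1, 3, 0]))))))),
  (.induced 5 0x0710090c0a, .fresh 9 (.ask 5 0 (.ask 0 5 (.goto 34 [0, 5]) (.ask 5 3 (.ask 3 5
    (.goto 27 [3, 5, 0]) (.ask 5 4 (.ask 4 5 (.goto 27 [4, 5, 3]) (.ask 5 1 (.ask 5 2 (.kill 5 3)
    (.goto 43 [4, 2, 5, 0, 3])) (.goto 42 [0, 1, 5, 3, 4]))) (.ask 5 1 (.ask 1 5 (.goto 27 [1, 5,
    0]) (.ask 5 2 (.kill 5 3) (.goto 44 [0, 1, 2, 3, 4, 5]))) (.ask 5 2 (.ask 2 5 (.kill 1 3)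
    (.goto 44 [2, 0, 1, 3, 4, 5])) (.goto 44 [5, 0, 1, 3, 4, 2]))))) (.ask 5 2 (.ask 2 5 (.goto 27
    [5, 2, 3]) (.ask 5 1 (.ask 1 5 (.goto 23 [1, 5, 0, 3]) (.ask 5 4 (.ask 4 5 (.goto 4 [4, 5, 0,
    1, 2, 3]) (.goto 46 [0, 1, 2, 3, 5, 4])) (.goto 46 [0, 1, 2, 3, 4, 5]))) (.goto 42 [2, 0, 1,
    3, 5]))) (.ask 5 4 (.ask 4 5 (.kill 2 5) (.goto 42 [5, 4, 2, 0, 3])) (.goto 43 [3, 4, 2, 5,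
    0]))))) (.ask 5 4 (.ask 4 5 (.goto 27 [5, 4, 0]) (.ask 5 1 (.ask 1 5 (.goto 18 [1, 5, 4, 0])
    (.ask 5 3 (.ask 3 5 (.kill 5 1) (.goto 43 [4, 0, 5, 1, 3])) (.goto 42 [5, 4, 0, 1, 3]))) (.ask
    5 2 (.ask 2 5 (.goto 16 [5, 2, 0, 1, 4]) (.goto 42 [1, 5, 4, 2, 0])) (.ask 5 3 (.ask 3 5
    (.goto 5 [0, 1, 2, 3, 5, 4]) (.goto 45 [0, 1, 2, 3, 4, 5])) (.goto 45 [0, 1, 2, 5, 4, 3])))))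
    (.ask 5 3 (.ask 3 5 (.goto 18 [5, 3, 4, 0]) (.ask 5 1 (.ask 1 5 (.kill 0 3) (.ask 5 2 (.ask 2
    5 (.goto 23 [5, 2, 0, 1]) (.goto 44 [1, 2, 0, 3, 4, 5])) (.goto 44 [5, 1, 2, 3, 4, 0]))) (.ask
    2 5 (.kill 4 5) (.goto 44 [5, 2, 0, 3, 4, 1])))) (.ask 1 5 (.ask 2 5 (.kill 4 5) (.goto 42 [0,
    3, 4, 5, 2])) (.goto 43 [3, 4, 0, 5, 1])))))),
  (.induced 4 0x00090c0a, .witness 0 3 (.ask 0 4 (.goto 34 [0, 4]) (.ask 4 3 (.goto 27 [3, 4, 0])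
    (.ask 4 1 (.ask 1 4 (.goto 23 [1, 4, 0, 3]) (.ask 4 2 (.ask 2 4 (.goto 23 [2, 4, 1, 3]) (.goto
    47 [0, 1, 2, 3, 4])) (.goto 42 [0, 1, 2, 3, 4]))) (.ask 4 2 (.ask 2 4 (.goto 27 [4, 2, 3])
    (.goto 42 [2, 0, 1, 3, 4])) (.goto 43 [0, 1, 2, 3, 4])))))),
  (.induced 6 0x0a2314310c2a, .witness 0 5 (.ask 6 1 (.ask 6 4 (.ask 6 2 (.kill 6 4) (.kill 2 0))
    (.kill 4 1)) (.ask 6 3 (.kill 5 3) (.kill 1 6)))),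
  (.induced 6 0x1f0314110c0a, .witness 5 4 (.ask 6 4 (.goto 34 [4, 6]) (.ask 6 1 (.ask 1 6 (.kill
    5 2) (.ask 5 6 (.goto 27 [6, 5, 4]) (.goto 48 [5, 4, 6, 1]))) (.ask 6 2 (.kill 5 0) (.goto 48
    [1, 2, 4, 6]))))),
  (.induced 5 0x0314110c0a, .fresh 3 (.ask 5 0 (.ask 0 5 (.goto 34 [0, 5]) (.ask 5 1 (.ask 1 5
    (.goto 27 [1, 5, 0]) (.ask 5 3 (.ask 3 5 (.kill 5 1) (.ask 5 2 (.ask 2 5 (.kill 5 3) (.ask 5 4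
    (.ask 4 5 (.kill 5 2) (.goto 50 [0, 1, 2, 3, 4, 5])) (.goto 42 [2, 4, 5, 0, 3]))) (.ask 5 4
    (.ask 4 5 (.kill 2 0) (.goto 42 [3, 2, 5, 4, 1])) (.goto 49 [5, 1, 2, 3, 4, 0])))) (.ask 5 2
    (.ask 2 5 (.kill 3 4) (.goto 42 [1, 3, 5, 2, 0])) (.ask 5 4 (.ask 4 5 (.kill 2 0) (.goto 49
    [5, 0, 3, 1, 2, 4])) (.goto 49 [4, 0, 3, 1, 2, 5]))))) (.ask 5 3 (.ask 3 5 (.goto 18 [3, 5, 0,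
    1]) (.goto 48 [0, 1, 5, 3])) (.ask 5 4 (.ask 4 5 (.kill 2 0) (.ask 5 2 (.ask 2 5 (.kill 3 4)
    (.goto 49 [5, 4, 1, 0, 3, 2])) (.goto 49 [2, 4, 1, 0, 3, 5]))) (.goto 42 [1, 3, 4, 5, 0])))))
    (.ask 5 4 (.ask 4 5 (.goto 27 [5, 4, 0]) (.ask 5 1 (.ask 1 5 (.goto 18 [1, 5, 4, 0]) (.goto 48
    [4, 0, 5, 1])) (.ask 5 2 (.ask 2 5 (.kill 3 4) (.ask 5 3 (.ask 3 5 (.kill 1 2) (.goto 49 [5,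
    2, 0, 4, 1, 3])) (.goto 49 [3, 2, 0, 4, 1, 5]))) (.goto 42 [0, 1, 2, 5, 4])))) (.ask 5 3 (.ask
    3 5 (.goto 18 [5, 3, 4, 0]) (.ask 5 1 (.ask 1 5 (.kill 0 3) (.ask 5 2 (.ask 2 5 (.kill 5 3)
    (.goto 49 [5, 3, 4, 2, 0, 1])) (.goto 49 [0, 1, 2, 3, 4, 5]))) (.ask 5 2 (.ask 2 5 (.kill 4 5)
    (.goto 49 [1, 3, 4, 2, 0, 5])) (.goto 42 [2, 4, 1, 5, 3])))) (.goto 48 [0, 3, 4, 5]))))),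
  (.induced 4 0x04010c0a, .witness 1 3 (.ask 1 4 (.goto 34 [1, 4]) (.ask 4 3 (.goto 27 [3, 4, 1])
    (.ask 4 2 (.ask 2 4 (.goto 18 [2, 4, 1, 3]) (.goto 48 [1, 3, 4, 2])) (.ask 4 0 (.ask 0 4
    (.goto 11 [4, 0, 3, 2, 1]) (.goto 51 [0, 1, 2, 3, 4])) (.goto 42 [3, 2, 0, 4, 1])))))),
  (.induced 4 0x07010402, .witness 3 2 (.ask 4 2 (.goto 34 [2, 4]) (.ask 3 4 (.goto 27 [4, 3, 2])
    (.ask 4 0 (.ask 0 4 (.goto 18 [0, 4, 3, 2]) (.goto 48 [3, 2, 4, 0])) (.goto 52 [3, 2, 4,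
    0]))))),
  (.induced 3 0x010402, .fresh 1 (.ask 3 0 (.ask 0 3 (.goto 34 [0, 3]) (.ask 3 1 (.ask 1 3 (.goto
    27 [1, 3, 0]) (.ask 3 2 (.ask 2 3 (.goto 27 [2, 3, 1]) (.goto 53 [0, 1, 2, 3])) (.goto 52 [2,
    3, 1, 0]))) (.ask 3 2 (.ask 2 3 (.goto 31 [2, 3, 0, 1]) (.goto 52 [1, 3, 0, 2])) (.goto 52 [1,
    2, 0, 3])))) (.ask 3 1 (.ask 1 3 (.goto 33 [1, 3, 0]) (.ask 3 2 (.ask 2 3 (.goto 23 [3, 2, 0,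
    1]) (.goto 52 [0, 3, 2, 1])) (.goto 52 [2, 0, 1, 3]))) (.ask 3 2 (.ask 2 3 (.goto 18 [3, 2, 0,
    1]) (.goto 52 [0, 1, 2, 3])) (.goto 48 [0, 1, 2, 3])))))]

theorem checkAll_refutations :
    checkAll (List.ofFn fun k => ⟨(dicriticalCodes k).1, (dicriticalCodes k).2, 0⟩)
      refutations = true := by
  decide +kernel

section

variable {D : Digraph V}

theorem realizes_digon {x y : V} (hne : x ≠ y) (hxy : D.Adj x y) (hyx : D.Adj y x) :
    (Pattern.induced 2 0x0102).Realizes D fun i => if i = 0 then x else y := by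
  have h1 : ∀ i < 2, ∀ j < 2, hasBit 0x0102 i j = true → i = 0 ∧ j = 1 ∨ i = 1 ∧ j = 0 := by
    decide
  have h2 : ∀ i < 2, ∀ j < 2, ¬ hasBit (Pattern.induced 2 0x0102).nonArcs i j = true := by decide
  refine ⟨fun i hi j hj hij => ?_, fun i hi j hj hij => ?_, fun i hi j hj hij => ?_⟩
  · replace hi : i < 2 := hi
    replace hj : j < 2 := hj
    interval_cases i <;> interval_cases j <;> simp_all
  · rcases h1 i hi j hj hij with ⟨rfl, rfl⟩ | ⟨rfl, rfl⟩ <;> simpa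
  · exact absurd hij (h2 i hi j hj)

theorem realizes_triangle {x y z : V} (hl : D.IsLoopless) (hd : ∀ x y, D.Adj x y → ¬ D.Adj y x)
    (hxy : D.Adj x y) (hyz : D.Adj y z) (hzx : D.Adj z x) :
    (Pattern.induced 3 0x010402).Realizes D
      fun i => if i = 0 then x else if i = 1 then y else z := by
  have h1 : ∀ i < 3, ∀ j < 3, hasBit 0x010402 i j = true →
      i = 0 ∧ j = 1 ∨ i = 1 ∧ j = 2 ∨ i = 2 ∧ j = 0 := by
    decide
  have h2 : ∀ i < 3, ∀ j < 3, hasBit (Pattern.induced 3 0x010402).nonArcs i j = true →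
      i = 1 ∧ j = 0 ∨ i = 2 ∧ j = 1 ∨ i = 0 ∧ j = 2 := by
    decide
  have hne : x ≠ y ∧ y ≠ z ∧ x ≠ z := by
    refine ⟨?_, ?_, ?_⟩ <;> rintro rfl
    exacts [hl _ hxy, hl _ hyz, hl _ hzx]
  obtain ⟨hne1, hne2, hne3⟩ := hne
  refine ⟨fun i hi j hj hij => ?_, fun i hi j hj hij => ?_, fun i hi j hj hij => ?_⟩
  · replace hi : i < 3 := hi
    replace hj : j < 3 := hj
    interval_cases i <;> interval_cases j <;> simp_all
  · rcases h1 i hi j hj hij with ⟨rfl, rfl⟩ | ⟨rfl, rfl⟩ | ⟨rfl, rfl⟩ <;> simpa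
  · rcases h2 i hi j hj hij with ⟨rfl, rfl⟩ | ⟨rfl, rfl⟩ | ⟨rfl, rfl⟩ <;> simpa using hd _ _ ‹_›

/-- One of the eight digraphs occurs in every critical semicomplete digraph: otherwise
`refutations` excludes digons and triangles, and the constant colouring is good. -/
theorem IsCritical.exists_realizes (hl : D.IsLoopless) (hs : D.IsSemicomplete)
    (hD : D.IsCritical) :
    ∃ k f, Pattern.Realizes ⟨(dicriticalCodes k).1, (dicriticalCodes k).2, 0⟩ D f := by
  by_contra hcon
  push Not at hcon
  have hall := excluded_of_checkAll hl hs hD _ _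
    (fun P hP => by obtain ⟨k, rfl⟩ := List.mem_ofFn.1 hP; exact hcon k) checkAll_refutations
  have hall' : ∀ P ∈ refutations.map Prod.fst, P.Excluded D := by simpa using hall
  have hdigon : ∀ x y, D.Adj x y → ¬ D.Adj y x := fun x y hxy hyx =>
    hall' _ (by decide +kernel) _ (realizes_digon (by rintro rfl; exact hl _ hxy) hxy hyx)
  refine hD.not_good (fun _ => true) fun x y hxy _ => ⟨hdigon x y hxy, fun z _ hyz hzx => ?_⟩
  exact hall' _ (by decide +kernel) _ (realizes_triangle hl hdigon hxy hyz hzx)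

end

/-! ### The eight digraphs -/

section

variable {D : Digraph V}

/-- The digraph on `n` vertices with code `c` is semicomplete and critical. -/
def isCriticalCode (n c : ℕ) : Bool :=
  decide (0 < n) && (decide (n ≤ 8) && (!canDistribute c (others n []) [] [] &&
    (List.range n).all fun u => (List.range n).all fun v =>
      (decide (u = v) || (hasBit c u v || hasBit c v u)) &&
      (!hasBit c u v || (List.range (2 ^ n)).any fun m =>
        (m.testBit u == m.testBit v) && isGoodMask n (hasBit (revCode c u v)) m)))

theorem isCriticalCode_dicriticalCodes :
    ∀ k, isCriticalCode (dicriticalCodes k).1 (dicriticalCodes k).2 = true := by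
  decide +kernel

/-- `D` is isomorphic to the digraph on `p.1` vertices with code `p.2`. -/
def HasCode (D : Digraph V) (p : ℕ × ℕ) : Prop :=
  ∃ e : Fin p.1 ≃ V, ∀ i j : Fin p.1, D.Adj (e i) (e j) ↔ hasBit p.2 i j

theorem HasCode.isIsomorphic {p : ℕ × ℕ} {E : Digraph W} (hD : D.HasCode p) (hE : E.HasCode p) :
    D.IsIsomorphic E := by
  obtain ⟨e, he⟩ := hD
  obtain ⟨e', he'⟩ := hE
  refine ⟨⟨e.symm.trans e', fun {a b} => ?_⟩⟩
  simp [he', ← he]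

theorem HasCode.of_isIsomorphic {p : ℕ × ℕ} {E : Digraph W} (hE : E.HasCode p)
    (h : D.IsIsomorphic E) : D.HasCode p := by
  obtain ⟨e, he⟩ := hE
  obtain ⟨i⟩ := h
  refine ⟨e.trans i.symm.toEquiv, fun a b => ?_⟩
  rw [← he, ← i.map_rel_iff]
  simp

theorem HasCode.isCritical {n c : ℕ} (h : D.HasCode (n, c)) (hc : isCriticalCode n c = true) :
    D.IsSemicomplete ∧ D.IsCritical := by
  obtain ⟨e, he⟩ := h
  simp only [isCriticalCode, Bool.and_eq_true, decide_eq_true_eq, Bool.not_eq_true',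
    List.all_eq_true, List.mem_range, Bool.or_eq_true, List.any_eq_true, beq_iff_eq] at hc
  obtain ⟨hpos, hn, hcol, hc⟩ := hc
  have hadj : ∀ x y, D.Adj x y ↔ hasBit c (e.symm x) (e.symm y) = true := fun x y => by
    rw [← he]; simp
  refine ⟨fun x y hxy => ?_, fun φ hφ => ?_, fun x y hxy => ?_⟩
  · rw [hadj, hadj]
    refine ((hc _ (e.symm x).2 _ (e.symm y).2).1).resolve_left fun h => hxy ?_
    exact e.symm.injective (Fin.ext h)
  · have := canDistribute_eq_true (c := c)
      (f := fun i => if h : i < n then e ⟨i, h⟩ else e ⟨0, hpos⟩) (vs := List.range n) hφ (fun i hi j hj hij => ?_)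
      (others n []) [] [] true
      (by simp [mem_others]) (by simp) (by simp) (by simp) (by simp)
    · rw [hcol] at this
      exact Bool.noConfusion this
    · rw [List.mem_range] at hi hj
      simpa [hi, hj, he] using hij
  · obtain ⟨m, hm, huv, hg⟩ := ((hc _ (e.symm x).2 _ (e.symm y).2).2).resolve_left
      (by simpa using (hadj x y).1 hxy)
    refine ⟨_, huv, isGood_of_isGoodMask (g := fun z => (e.symm z : ℕ)) (fun z => (e.symm z).2)
      (fun z w hzw => ?_) hg⟩
    have h1 := (e.symm x).2
    have h2 := (e.symm y).2
    have h3 := (e.symm w).2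
    rw [hasBit_revCode (by omega) (by omega) (by omega)]
    rcases hzw with ⟨hzw, hne⟩ | ⟨rfl, rfl⟩
    · have : ¬ ((e.symm z : ℕ) = e.symm x ∧ (e.symm w : ℕ) = e.symm y) := by
        rintro ⟨h4, h5⟩
        exact hne ⟨e.symm.injective (Fin.ext h4), e.symm.injective (Fin.ext h5)⟩
      rw [not_and_or] at this
      simpa [(hadj z w).1 hzw, Fin.ext_iff, imp_iff_not_or] using Or.inl this
    · simp

/-- A critical digraph that contains a critical digraph has no further arc, since reversing that
arc would give a good colouring of the smaller one, and hence no further vertex. -/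
theorem IsCritical.hasCode {n c : ℕ} {f : ℕ → V} (hs : D.IsSemicomplete)
    (hD : D.IsCritical) (h : Pattern.Realizes ⟨n, c, 0⟩ D f) (hc : isCriticalCode n c = true) :
    D.HasCode (n, c) := by
  simp only [isCriticalCode, Bool.and_eq_true, decide_eq_true_eq, Bool.not_eq_true'] at hc
  obtain ⟨hpos, hn, hcol, -⟩ := hc
  have key : ∀ x y, D.Adj x y → ∃ i < n, ∃ j < n, f i = x ∧ f j = y ∧ hasBit c i j = true := by
    intro x y hxy
    by_contra hcon
    push Not at hcon
    obtain ⟨φ, -, hφ⟩ := hD.good x y hxy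
    have := canDistribute_eq_true (c := c) (f := f) (vs := List.range n) hφ
      (fun i hi j hj hij => ?_) (others n []) [] [] true
      (by simp [mem_others]) (by simp) (by simp) (by simp) (by simp)
    · rw [hcol] at this
      exact Bool.noConfusion this
    · rw [List.mem_range] at hi hj
      exact Or.inl ⟨h.adj i hi j hj hij, fun hij' => hcon i hi j hj hij'.1 hij'.2 hij⟩
  have hsurj : ∀ x, ∃ i < n, f i = x := by
    intro x
    by_cases hx : x = f 0
    · exact ⟨0, hpos, hx.symm⟩
    · rcases hs x (f 0) hx with hadj | hadj
      · obtain ⟨i, hi, -, -, hix, -⟩ := key _ _ hadj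
        exact ⟨i, hi, hix⟩
      · obtain ⟨-, -, i, hi, -, hix, -⟩ := key _ _ hadj
        exact ⟨i, hi, hix⟩
  refine ⟨Equiv.ofBijective (fun i : Fin n => f i) ⟨fun i j hij => ?_, fun x => ?_⟩, ?_⟩
  · exact Fin.ext (h.injOn i i.2 j j.2 hij)
  · obtain ⟨i, hi, hix⟩ := hsurj x
    exact ⟨⟨i, hi⟩, hix⟩
  · intro i j
    refine ⟨fun hij => ?_, fun hij => h.adj i i.2 j j.2 hij⟩
    obtain ⟨i', hi', j', hj', h1, h2, h3⟩ := key _ _ hij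
    rwa [h.injOn i' hi' i i.2 h1, h.injOn j' hj' j j.2 h2] at h3

instance (n : ℕ) : DecidableRel (bidirectedComplete n).Adj := fun i j =>
  inferInstanceAs (Decidable (i ≠ j))
instance (n : ℕ) : DecidableRel (directedCycle n).Adj := fun i j =>
  inferInstanceAs (Decidable ((j : ℕ) = ((i : ℕ) + 1) % n))
instance : DecidableRel directedWheel3.Adj
  | none, none => isFalse id
  | none, some _ => isTrue trivial
  | some _, none => isTrue trivial
  | some i, some j => inferInstanceAs (Decidable ((directedCycle 3).Adj i j))
instance : DecidableRel H5.Adj := fun i j => inferInstanceAs (Decidable ((i, j) ∈ (_ : List _)))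
instance : DecidableRel paley7.Adj := fun _ _ => inferInstanceAs (Decidable (_ ∨ _))
instance {V W : Type*} (H₁ : Digraph V) (H₂ : Digraph W) [DecidableRel H₁.Adj]
    [DecidableRel H₂.Adj] : DecidableRel (rotative H₁ H₂).Adj
  | some (.inl a), some (.inl b) => inferInstanceAs (Decidable (H₁.Adj a b))
  | some (.inr a), some (.inr b) => inferInstanceAs (Decidable (H₂.Adj a b))
  | some (.inl _), some (.inr _) => isTrue trivial
  | some (.inr _), none => isTrue trivial
  | none, some (.inl _) => isTrue trivial
  | some (.inr _), some (.inl _) => isFalse id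
  | some (.inl _), none => isFalse id
  | none, some (.inr _) => isFalse id
  | none, none => isFalse id

theorem hasCode_of_bijective {n c : ℕ} (f : Fin n → V) (hf : Function.Bijective f)
    (h : ∀ i j, D.Adj (f i) (f j) ↔ hasBit c i j) : D.HasCode (n, c) :=
  ⟨Equiv.ofBijective f hf, h⟩

theorem hasCode_eightDigraphs (k : Fin 8) : (eightDigraphs k).2.HasCode (dicriticalCodes k) := by
  fin_cases k
  · exact hasCode_of_bijective (D := bidirectedComplete 3) ![0, 1, 2] (by decide) (by decide)
  · exact hasCode_of_bijective (D := directedWheel3) ![some 0, some 1, some 2, none] (by decide)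
      (by decide)
  · exact hasCode_of_bijective (D := H5) ![0, 1, 2, 3, 4] (by decide) (by decide)
  · exact hasCode_of_bijective (D := rotative (bidirectedComplete 2) (bidirectedComplete 2))
      ![some (.inl 0), some (.inl 1), some (.inr 0), some (.inr 1), none] (by decide) (by decide)
  · exact hasCode_of_bijective (D := rotative (bidirectedComplete 2) (directedCycle 3))
      ![some (.inl 0), some (.inl 1), some (.inr 0), some (.inr 1), some (.inr 2), none]
      (by decide) (by decide)
  · exact hasCode_of_bijective (D := rotative (directedCycle 3) (bidirectedComplete 2))
      ![some (.inl 0), some (.inl 1), some (.inl 2), some (.inr 0), some (.inr 1), none]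
      (by decide) (by decide)
  · exact hasCode_of_bijective (D := rotative (directedCycle 3) (directedCycle 3))
      ![some (.inl 0), some (.inl 1), some (.inl 2), some (.inr 0), some (.inr 1), some (.inr 2),
        none] (by decide) (by decide)
  · exact hasCode_of_bijective (D := paley7) (fun i => ((i : ℕ) : ZMod 7))
      (by decide) (by decide)

/-! ### The eight digraphs are not isomorphic -/

/-- The pairs formed by the out-degree of a vertex and the number of digons at it. This
isomorphism invariant distinguishes the eight digraphs. -/
def degreeProfile (p : ℕ × ℕ) : Finset (ℕ × ℕ) :=
  Finset.univ.image fun i : Fin p.1 =>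
    ((Finset.univ.filter fun j : Fin p.1 => hasBit p.2 i j).card,
      (Finset.univ.filter fun j : Fin p.1 => hasBit p.2 i j ∧ hasBit p.2 j i).card)

theorem HasCode.degreeProfile_eq {p q : ℕ × ℕ} (hp : D.HasCode p) (hq : D.HasCode q) :
    degreeProfile p = degreeProfile q := by
  obtain ⟨e, he⟩ := hp
  obtain ⟨e', he'⟩ := hq
  set s := e.trans e'.symm with hsdef
  have hs : ∀ i j : Fin p.1, hasBit p.2 i j = hasBit q.2 (s i) (s j) := fun i j => by
    rw [Bool.eq_iff_iff, ← he, ← he']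
    simp [hsdef]
  ext x
  simp only [degreeProfile, Finset.mem_image, Finset.mem_univ, true_and, hs]
  rw [s.exists_congr_left]
  refine exists_congr fun i => ?_
  rw [Equiv.apply_symm_apply]
  have h1 : ∀ P : Fin q.1 → Prop, [DecidablePred P] →
      (Finset.univ.filter fun j => P (s j)).card = (Finset.univ.filter P).card := by
    intro P _
    exact Finset.card_bij (fun j _ => s j) (by simp) (fun a _ b _ h => s.injective h)
      (fun b hb => ⟨s.symm b, by simpa using hb, by simp⟩)
  rw [h1 fun j => hasBit q.2 i j = true, h1 fun j => hasBit q.2 i j = true ∧ hasBit q.2 j i = true]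

theorem degreeProfile_injective :
    ∀ k l, k ≠ l → degreeProfile (dicriticalCodes k) ≠ degreeProfile (dicriticalCodes l) := by
  decide +kernel

end

end Digraph

theorem theorem2 :
    (∀ {V : Type*} [Finite V] (D : Digraph V), D.IsLoopless →
      ((D.IsSemicomplete ∧ D.IsDicritical 3) ↔
        ∃ i : Fin 8, D.IsIsomorphic (Digraph.eightDigraphs i).2)) ∧
    (∀ i j : Fin 8, i ≠ j →
      ¬ (Digraph.eightDigraphs i).2.IsIsomorphic (Digraph.eightDigraphs j).2) := by
  refine ⟨fun D hl => ⟨?_, ?_⟩, fun i j hij h => ?_⟩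
  · rintro ⟨hs, hD⟩
    rw [Digraph.isDicritical_three_iff hl hs] at hD
    obtain ⟨k, f, hf⟩ := hD.exists_realizes hl hs
    exact ⟨k, (hD.hasCode hs hf (Digraph.isCriticalCode_dicriticalCodes k)).isIsomorphic
      (Digraph.hasCode_eightDigraphs k)⟩
  · rintro ⟨k, hk⟩
    obtain ⟨hs, hD⟩ := ((Digraph.hasCode_eightDigraphs k).of_isIsomorphic hk).isCritical
      (Digraph.isCriticalCode_dicriticalCodes k)
    exact ⟨hs, (Digraph.isDicritical_three_iff hl hs).2 hD⟩
  · exact Digraph.degreeProfile_injective i j hij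
      ((Digraph.hasCode_eightDigraphs i).degreeProfile_eq
        ((Digraph.hasCode_eightDigraphs j).of_isIsomorphic h))
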